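/- For $X\in\mathbb R^{n\times d}$ with rows (data points) $x_1,\dots,x_n$, labels $Y\in\mathbb R^n$ and $\lambda>0$ put $$L_{X,Y}(\beta)=\|X\beta-Y\|_2^2+\lambda\|\beta\|_2^2\quad(\beta\in\mathbb R^d),\qquad \mathsf{sd}_\lambda(X)=\sum_{i=1}^{\mathrm{rank}(X)}\frac{1}{1+\lambda/\sigma_i(X)^2},$$ where $\sigma_1(X)\ge\sigma_2(X)\ge\cdots$ are the singular values of $X$. An active learner is a randomized algorithm whose random seed is independent of $Y$. It proceeds in a fixed, arbitrarily large finite number of rounds; in each round it may query the label $Y_i$ of one data point $x_i$, or make no query, depending measurably on its seed and on the labels received so far. At the end it outputs a vector $\widehat\beta\in\mathbb R^d$ depending measurably on its seed and on the labels received. The learner may be chosen knowing $X$, $\lambda$, $\epsilon$ and the distribution of $Y$. **Theorem.** There is an absolute constant $c>0$ such that for every integer $d\ge 0$, every $0<\epsilon\le \frac1{100}$ and every $\lambda\in[1,50]$ there is a random ridge regression instance $(X,Y)$, that is, an integer $n$, a matrix $X\in\mathbb R^{n\times d}$ and a probability distribution of the label vector $Y\in\mathbb R^n$, with $\mathsf{sd}_\lambda(X)=\frac{d}{1+\lambda}$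 and the following property. If the output $\widehat\beta$ of an active learner satisfies $$\|X\widehat\beta-Y\|_2^2+\lambda\|\widehat\beta\|_2^2\le(1+0.001\,\epsilon)\,\min_{\beta\in\mathbb R^d}\left(\|X\beta-Y\|_2^2+\lambda\|\beta\|_2^2\right)$$ with probability at least $\frac34$ over $Y$ and the seed of the learner, then the expected number of labels that the learner queries (hence also its worst-case number of queries) is at least $c\,\mathsf{sd}_\lambda(X)/\epsilon$. -/

import Mathlib

open MeasureTheory
open scoped Matrix

/-- The ridge regression objective `‖X β - y‖₂² + lam * ‖β‖₂²` (Euclidean norms). -/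
noncomputable def ridgeLoss {n d : ℕ} (lam : ℝ) (X : Matrix (Fin n) (Fin d) ℝ) (y : Fin n → ℝ)
    (β : Fin d → ℝ) : ℝ :=
  ‖WithLp.toLp 2 (X *ᵥ β - y)‖ ^ 2 + lam * ‖WithLp.toLp 2 β‖ ^ 2

/-- The optimal value of the ridge regression objective over all `β ∈ ℝᵈ`. -/
noncomputable def ridgeOpt {n d : ℕ} (lam : ℝ) (X : Matrix (Fin n) (Fin d) ℝ)
    (y : Fin n → ℝ) : ℝ :=
  ⨅ β : Fin d → ℝ, ridgeLoss lam X y β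

/-- The statistical dimension `∑_{i ≤ rank X} 1 / (1 + lam / σᵢ(X)²)`, where `σ₁(X) ≥ σ₂(X) ≥ …`
are the singular values of `X` (numbered from `0` in the code). -/
noncomputable def statDim {n d : ℕ} (lam : ℝ) (X : Matrix (Fin n) (Fin d) ℝ) : ℝ :=
  ∑ i ∈ Finset.range X.rank, 1 / (1 + lam / (Matrix.toEuclideanLin X).singularValues i ^ 2)

/-- A randomized adaptive learner for a dataset of `n` points in `ℝᵈ`, with random seed in `Ω`.
It works in `rounds` many rounds. In round `t` it decides, on the basis of its seed and of the
replies in the rounds `0, …, t - 1`, either to query the label of one of the `n` points (`some i`)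
or not to query anything (`none`, to which the reply is `0`). In the end it outputs a vector that
depends on its seed and on all the replies. The number of rounds is arbitrary and is not a cost;
only queries are. The decisions and the output are measurable. -/
structure ActiveLearner (Ω : Type*) [MeasurableSpace Ω] (n d : ℕ) where
  rounds : ℕ
  query : (t : ℕ) → Ω × (Fin t → ℝ) → Option (Fin n)
  output : Ω × (Fin rounds → ℝ) → (Fin d → ℝ)
  measurableSet_query : ∀ (t : ℕ) (o : Option (Fin n)), MeasurableSet {h | query t h = o}
  measurable_output : Measurable output

namespace ActiveLearner

variable {Ω : Type*} [MeasurableSpace Ω] {n d : ℕ}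

/-- The reply of the label oracle: the label of the queried point, or `0` if there is no query. -/
def reply (y : Fin n → ℝ) : Option (Fin n) → ℝ
  | none => 0
  | some i => y i

/-- The replies that the learner with seed `ω` sees in the first `t` rounds on the labels `y`. -/
def history (A : ActiveLearner Ω n d) (ω : Ω) (y : Fin n → ℝ) : (t : ℕ) → (Fin t → ℝ)
  | 0 => Fin.elim0
  | t + 1 => Fin.snoc (history A ω y t) (reply y (A.query t (ω, history A ω y t)))

/-- The number of label queries made by the learner with seed `ω` on the labels `y`. -/
def queryCount (A : ActiveLearner Ω n d) (ω : Ω) (y : Fin n → ℝ) : ℕ :=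
  ((Finset.range A.rounds).filter fun t => (A.query t (ω, A.history ω y t)).isSome).card

/-- The vector returned by the learner with seed `ω` on the labels `y`. -/
def estimate (A : ActiveLearner Ω n d) (ω : Ω) (y : Fin n → ℝ) : Fin d → ℝ :=
  A.output (ω, A.history ω y A.rounds)

end ActiveLearner

namespace ActiveLearner

/-! ### Runs of a learner and what they reveal -/

section Runs

variable {Ω : Type*} [MeasurableSpace Ω] {n d : ℕ}

/-! Needles in haystacks. Take `m` copies of each row `eⱼ / √m`, so that `XᵀX = 1`, and give each
block a single nonzero label, of random sign `sⱼ` at a uniform position. The loss splits over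
coordinates, with minimizer `sⱼ / (√m (1 + lam))`. A coordinate without the sign `sⱼ` costs at least
`1 / (m (1 + lam))` extra, while the optimum is at most `d`. So for `m` about `1 / (16 δ (1 +
lam))`, a `(1 + δ)`-approximation has at most `d / 16` wrong signs (`card_wrong_le`).

With fewer than `h = m / 4` queries in a block, the needle usually stays unseen and its sign can
only be guessed. `le_sum_update_wrong_add_many` makes this precise for each fixed seed: on average a
block has a wrong sign or at least `h` queries with total weight at least `3/8`. Success with
probability `3/4` allows at most `5/16` wrong signs per coordinate, so queries must supply the
remaining `1/16`, which is `h d / 16` expected queries. -/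

theorem history_congr (A : ActiveLearner Ω n d) (ω : Ω) {y y' : Fin n → ℝ} {t : ℕ}
    (h : ∀ s < t, ∀ i, A.query s (ω, A.history ω y s) = some i → y' i = y i) :
    A.history ω y' t = A.history ω y t := by
  induction t with
  | zero => rfl
  | succ t ih =>
    have ih := ih fun s hs => h s (hs.trans t.lt_succ_self)
    have hr : reply y' (A.query t (ω, A.history ω y t)) =
        reply y (A.query t (ω, A.history ω y t)) := by
      cases hq : A.query t (ω, A.history ω y t) with
      | none => rfl
      | some i => exact h t t.lt_succ_self i hq
    simp only [history, ih, hr]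

theorem measurable_comp_query {β : Type*} [MeasurableSpace β] (A : ActiveLearner Ω n d) (t : ℕ)
    (g : Option (Fin n) → β) : Measurable fun h => g (A.query t h) := by
  let _ : MeasurableSpace (Option (Fin n)) := ⊤
  have hq : Measurable (A.query t) := measurable_to_countable' fun o => A.measurableSet_query t o
  exact measurable_from_top.comp hq

theorem measurable_history (A : ActiveLearner Ω n d) (y : Fin n → ℝ) (t : ℕ) :
    Measurable fun ω => A.history ω y t := by
  induction t with
  | zero => exact measurable_const
  | succ t ih =>
    refine measurable_pi_iff.2 fun s => ?_
    induction s using Fin.lastCases with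
    | last =>
      simp only [history, Fin.snoc_last]
      exact (A.measurable_comp_query t (reply y)).comp (measurable_id.prodMk ih)
    | cast s =>
      simp only [history, Fin.snoc_castSucc]
      exact (measurable_pi_apply s).comp ih

theorem measurable_estimate (A : ActiveLearner Ω n d) (y : Fin n → ℝ) :
    Measurable fun ω => A.estimate ω y :=
  A.measurable_output.comp (measurable_id.prodMk (A.measurable_history y _))

theorem measurable_queryCount (A : ActiveLearner Ω n d) (y : Fin n → ℝ) :
    Measurable fun ω => (A.queryCount ω y : ℝ) := by
  simp only [queryCount, Finset.card_filter, Nat.cast_sum]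
  refine Finset.measurable_sum _ fun t _ => ?_
  exact (A.measurable_comp_query t fun o => (((if o.isSome then 1 else 0 : ℕ)) : ℝ)).comp
    (measurable_id.prodMk (A.measurable_history y t))

theorem queryCount_le_rounds (A : ActiveLearner Ω n d) (ω : Ω) (y : Fin n → ℝ) :
    A.queryCount ω y ≤ A.rounds :=
  (Finset.card_filter_le _ _).trans (Finset.card_range _).le

theorem integrable_queryCount (A : ActiveLearner Ω n d) (P : Measure Ω) [IsFiniteMeasure P]
    (y : Fin n → ℝ) : Integrable (fun ω => (A.queryCount ω y : ℝ)) P := by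
  refine Integrable.of_bound (A.measurable_queryCount y).aestronglyMeasurable (A.rounds : ℝ)
    (.of_forall fun ω => ?_)
  simpa using A.queryCount_le_rounds ω y

/-- The number of queries in the first `t` rounds to points `i` with `b i = j`. -/
def blockCount (A : ActiveLearner Ω n d) (ω : Ω) (y : Fin n → ℝ) {ι : Type*} [DecidableEq ι]
    (b : Fin n → ι) (j : ι) (t : ℕ) : ℕ :=
  ((Finset.range t).filter fun s => (A.query s (ω, A.history ω y s)).map b = some j).card

theorem sum_blockCount (A : ActiveLearner Ω n d) (ω : Ω) (y : Fin n → ℝ) {ι : Type*} [Fintype ι]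
    [DecidableEq ι] (b : Fin n → ι) :
    ∑ j, A.blockCount ω y b j A.rounds = A.queryCount ω y := by
  simp only [blockCount, queryCount, Finset.card_filter]
  rw [Finset.sum_comm]
  refine Finset.sum_congr rfl fun s _ => ?_
  cases A.query s (ω, A.history ω y s) <;> simp

/-- A stopping time: the count grows by at most one per round, so it cannot jump over `h`. -/
theorem exists_blockCount_le (A : ActiveLearner Ω n d) (ω : Ω) (y : Fin n → ℝ) {ι : Type*}
    [DecidableEq ι] (b : Fin n → ι) (j : ι) (h R : ℕ) :
    ∃ t ≤ R, A.blockCount ω y b j t ≤ h ∧ (t = R ∨ h ≤ A.blockCount ω y b j t) := by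
  induction R with
  | zero => exact ⟨0, le_rfl, by simp [blockCount], .inl rfl⟩
  | succ R ih =>
    obtain ⟨t, htR, hle, ht⟩ := ih
    by_cases hh : h ≤ A.blockCount ω y b j t
    · exact ⟨t, htR.trans R.le_succ, hle, .inr hh⟩
    · obtain rfl : t = R := ht.resolve_right hh
      refine ⟨t + 1, le_rfl, ?_, .inl rfl⟩
      have : A.blockCount ω y b j (t + 1) ≤ A.blockCount ω y b j t + 1 := by
        unfold blockCount
        rw [Finset.range_add_one, Finset.filter_insert]
        split_ifs
        · exact Finset.card_insert_le _ _
        · exact Nat.le_succ _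
      omega

/-- Unless the labels differ from those of a reference run at one of `h` points of the block, the
learner either makes at least `h` queries in the block or cannot tell the labels apart. -/
theorem exists_queried_finset (A : ActiveLearner Ω n d) (ω : Ω) (y₀ : Fin n → ℝ) {ι : Type*}
    [DecidableEq ι] (b : Fin n → ι) (j : ι) (h : ℕ) :
    ∃ T : Finset (Fin n), T.card ≤ h ∧ ∀ y : Fin n → ℝ, (∀ i, b i ≠ j → y i = y₀ i) →
      (∀ i ∈ T, y i = y₀ i) →
      h ≤ A.blockCount ω y b j A.rounds ∨ A.estimate ω y = A.estimate ω y₀ := by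
  classical
  obtain ⟨t, htR, hle, ht⟩ := A.exists_blockCount_le ω y₀ b j h A.rounds
  -- The block points queried by the reference run before its stopping time; until then, labels
  -- agreeing there give the same history.
  refine ⟨Finset.univ.filter fun i => b i = j ∧
    ∃ s < t, A.query s (ω, A.history ω y₀ s) = some i, ?_, fun y hb hT => ?_⟩
  · refine le_trans ?_ hle
    rw [← Finset.card_map Function.Embedding.some]
    refine le_trans (Finset.card_le_card ?_) (Finset.card_image_le
      (f := fun s => A.query s (ω, A.history ω y₀ s)))
    intro o ho
    obtain ⟨i, hi, rfl⟩ := Finset.mem_map.1 ho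
    obtain ⟨hij, s, hs, hq⟩ := (Finset.mem_filter.1 hi).2
    exact Finset.mem_image.2 ⟨s, by simp [hs, hq, hij], hq⟩
  · have hist : ∀ s ≤ t, A.history ω y s = A.history ω y₀ s := fun s hs =>
      A.history_congr ω fun r hr i hi => by
        by_cases hij : b i = j
        · exact hT i (by simpa using ⟨hij, r, hr.trans_le hs, hi⟩)
        · exact hb i hij
    rcases ht with rfl | ht
    · right
      simp only [estimate, hist _ le_rfl]
    · left
      have hbc : A.blockCount ω y b j t = A.blockCount ω y₀ b j t := by
        unfold blockCount
        congr 1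
        refine Finset.filter_congr fun s hs => ?_
        rw [hist s (Finset.mem_range.1 hs).le]
      rw [← hbc] at ht
      refine ht.trans (Finset.card_le_card (Finset.filter_subset_filter _ ?_))
      exact Finset.range_subset_range.2 htR

end Runs

end ActiveLearner

/-! ### The hard instance and its loss -/

section Design

/-- The value of a sign. -/
def boolSign (s : Bool) : ℝ := if s then 1 else -1

theorem boolSign_sq (s : Bool) : boolSign s ^ 2 = 1 := by cases s <;> norm_num [boolSign]

/-- The design with `m` copies of each of the rows `eⱼ / √m`. -/
noncomputable def blockDesign (d m : ℕ) : Matrix (Fin (d * m)) (Fin d) ℝ :=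
  Matrix.of fun i j => if (finProdFinEquiv.symm i).1 = j then (√m)⁻¹ else 0

/-- The labels with one nonzero label in each block, at position `(z j).2` and of sign
`(z j).1`. -/
def needleLabels {d m : ℕ} (z : Fin d → Bool × Fin m) : Fin (d * m) → ℝ := fun i =>
  if (z (finProdFinEquiv.symm i).1).2 = (finProdFinEquiv.symm i).2 then
    boolSign (z (finProdFinEquiv.symm i).1).1 else 0

theorem blockDesign_mulVec {d m : ℕ} (β : Fin d → ℝ) (i : Fin (d * m)) :
    (blockDesign d m *ᵥ β) i = (√m)⁻¹ * β (finProdFinEquiv.symm i).1 := by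
  simp [blockDesign, Matrix.mulVec, dotProduct]

theorem blockDesign_transpose_mul_self {d m : ℕ} (hm : 0 < m) :
    (blockDesign d m)ᵀ * blockDesign d m = 1 := by
  have hm' : (m : ℝ) ≠ 0 := by positivity
  ext j j'
  rw [Matrix.mul_apply, ← finProdFinEquiv.sum_comp, Fintype.sum_prod_type]
  by_cases h : j = j'
  · subst h
    simp [blockDesign, -finProdFinEquiv_symm_apply, Finset.sum_ite_irrel, ← mul_inv, hm']
  · rw [Matrix.one_apply_ne h]
    refine Finset.sum_eq_zero fun a _ => Finset.sum_eq_zero fun k _ => ?_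
    simp only [blockDesign, Matrix.transpose_apply, Matrix.of_apply, Equiv.symm_apply_apply]
    grind

/-- Squared singular values are eigenvalues of `XᵀX = 1`, hence all equal 1. -/
theorem statDim_eq_of_transpose_mul_self {n d : ℕ} {X : Matrix (Fin n) (Fin d) ℝ}
    (hX : Xᵀ * X = 1) (lam : ℝ) : statDim lam X = d / (1 + lam) := by
  have hrank : X.rank = d := by
    rw [← Matrix.rank_transpose_mul_self, hX, Matrix.rank_one, Fintype.card_fin]
  have hT : LinearMap.adjoint (Matrix.toEuclideanLin X) ∘ₗ Matrix.toEuclideanLin X = 1 := by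
    rw [← Matrix.toEuclideanLin_conjTranspose_eq_adjoint]
    ext v i
    have := congrFun (congrArg (fun M => M *ᵥ (v : Fin d → ℝ)) hX) i
    simpa [Matrix.toLpLin_apply, Matrix.mulVec_mulVec,
      Matrix.conjTranspose_eq_transpose_of_trivial] using this
  have hs : ∀ i < d, (Matrix.toEuclideanLin X).singularValues i ^ 2 = 1 := by
    intro i hi
    have h := (Matrix.toEuclideanLin X).hasEigenvalue_adjoint_comp_self_sq_singularValues
      (n := i) (by simpa using hi)
    rw [hT] at h
    obtain ⟨v, hv⟩ := h.exists_hasEigenvector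
    have h1 := hv.apply_eq_smul
    have h2 : (1 - (Matrix.toEuclideanLin X).singularValues i ^ 2) • v = 0 := by
      rw [sub_smul, one_smul, sub_eq_zero]
      simpa using h1
    have := (smul_eq_zero.1 h2).resolve_right hv.2
    linarith
  rw [statDim, hrank, Finset.sum_congr rfl fun i hi => by rw [hs i (Finset.mem_range.1 hi)]]
  simp [div_eq_mul_inv]

theorem ridgeLoss_blockDesign {d m : ℕ} (hm : 0 < m) (lam : ℝ) (z : Fin d → Bool × Fin m)
    (β : Fin d → ℝ) :
    ridgeLoss lam (blockDesign d m) (needleLabels z) β =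
      ∑ j, ((1 + lam) * β j ^ 2 - 2 * (√m)⁻¹ * boolSign (z j).1 * β j + 1) := by
  have hm' : (m : ℝ) * (√m)⁻¹ ^ 2 = 1 := by
    have : (m : ℝ) ≠ 0 := by positivity
    rw [inv_pow, Real.sq_sqrt (Nat.cast_nonneg m), mul_inv_cancel₀ this]
  rw [ridgeLoss, EuclideanSpace.norm_sq_eq, EuclideanSpace.norm_sq_eq, Finset.mul_sum,
    ← finProdFinEquiv.sum_comp, Fintype.sum_prod_type, ← Finset.sum_add_distrib]
  refine Finset.sum_congr rfl fun j _ => ?_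
  have key : ∀ k : Fin m,
      ‖((blockDesign d m *ᵥ β - needleLabels z) (finProdFinEquiv (j, k)))‖ ^ 2 =
      (√m)⁻¹ ^ 2 * β j ^ 2 +
        (if (z j).2 = k then 1 - 2 * (√m)⁻¹ * boolSign (z j).1 * β j else 0) := by
    intro k
    rw [Pi.sub_apply, blockDesign_mulVec, needleLabels, Real.norm_eq_abs, sq_abs]
    simp only [Equiv.symm_apply_apply]
    split_ifs
    · linear_combination boolSign_sq (z j).1
    · ring
  rw [Finset.sum_congr rfl fun k _ => key k]
  simp only [Finset.sum_add_distrib, Finset.sum_ite_eq, Finset.mem_univ, if_true,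
    Finset.sum_const, Finset.card_univ, Fintype.card_fin, nsmul_eq_mul, Real.norm_eq_abs, sq_abs]
  linear_combination β j ^ 2 * hm'

theorem ridgeOpt_le {n d : ℕ} {lam : ℝ} (hlam : 0 ≤ lam) (X : Matrix (Fin n) (Fin d) ℝ)
    (y : Fin n → ℝ) (β : Fin d → ℝ) : ridgeOpt lam X y ≤ ridgeLoss lam X y β :=
  ciInf_le ⟨0, by rintro _ ⟨β, rfl⟩; unfold ridgeLoss; positivity⟩ β

/-- A near-optimal vector has the wrong sign in few coordinates. -/
theorem card_wrong_le {d m : ℕ} (hm : 0 < m) {lam δ : ℝ} (hlam : 0 ≤ lam) (hδ : 0 ≤ δ)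
    (z : Fin d → Bool × Fin m) (β : Fin d → ℝ)
    (h : ridgeLoss lam (blockDesign d m) (needleLabels z) β ≤
      (1 + δ) * ridgeOpt lam (blockDesign d m) (needleLabels z)) :
    ∑ j, (if β j * boolSign (z j).1 ≤ 0 then (1 : ℝ) else 0) ≤ δ * (1 + lam) * m * d := by
  have hm0 : (0 : ℝ) < m := by positivity
  have hl : 0 < 1 + lam := by positivity
  set r : ℝ := (√m)⁻¹ with hr
  have hr2 : r ^ 2 = (m : ℝ)⁻¹ := by rw [hr, inv_pow, Real.sq_sqrt hm0.le]
  have hr0 : 0 < r := by positivity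
  have h0 := ridgeOpt_le hlam (blockDesign d m) (needleLabels z) 0
  -- The test vector is the coordinatewise minimizer; the zero vector above bounds the optimum by
  -- `d`.
  have h1 := ridgeOpt_le hlam (blockDesign d m) (needleLabels z)
    fun j => r * boolSign (z j).1 / (1 + lam)
  rw [ridgeLoss_blockDesign hm] at h h0 h1
  simp only [Pi.zero_apply, ne_eq, OfNat.ofNat_ne_zero, not_false_eq_true, zero_pow, mul_zero,
    sub_zero, zero_add, Finset.sum_const, Finset.card_univ, Fintype.card_fin, nsmul_eq_mul,
    mul_one] at h0
  have h2 : ∑ j, ((1 + lam) * (r * boolSign (z j).1 / (1 + lam)) ^ 2 -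
        2 * r * boolSign (z j).1 * (r * boolSign (z j).1 / (1 + lam)) + 1) +
      r ^ 2 / (1 + lam) * ∑ j, (if β j * boolSign (z j).1 ≤ 0 then (1 : ℝ) else 0) ≤
      ∑ j, ((1 + lam) * β j ^ 2 - 2 * r * boolSign (z j).1 * β j + 1) := by
    rw [Finset.mul_sum, ← Finset.sum_add_distrib]
    refine Finset.sum_le_sum fun j _ => ?_
    have hs := boolSign_sq (z j).1
    set s := boolSign (z j).1
    have e1 : (1 + lam) * (r * s / (1 + lam)) ^ 2 - 2 * r * s * (r * s / (1 + lam)) + 1 =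
        1 - r ^ 2 / (1 + lam) := by
      field_simp
      linear_combination (-r ^ 2) * hs
    rw [e1]
    -- With a wrong sign the cross term is nonnegative, so the summand is at least 1; otherwise
    -- complete the square.
    split_ifs with hw
    · nlinarith [sq_nonneg (β j), mul_nonneg hr0.le (neg_nonneg.2 hw),
        mul_nonneg hl.le (sq_nonneg (β j))]
    · have e2 : (1 + lam) * β j ^ 2 - 2 * r * s * β j + r ^ 2 / (1 + lam) =
          (1 + lam) * (β j - r * s / (1 + lam)) ^ 2 := by
        field_simp
        linear_combination (-r ^ 2) * hs
      have := mul_nonneg hl.le (sq_nonneg (β j - r * s / (1 + lam)))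
      linarith
  have h3 : r ^ 2 / (1 + lam) * ∑ j, (if β j * boolSign (z j).1 ≤ 0 then (1 : ℝ) else 0) ≤
      δ * d := by
    nlinarith [mul_le_mul_of_nonneg_left h0 hδ]
  rw [hr2] at h3
  have h4 := mul_le_mul_of_nonneg_left h3 (mul_pos hm0 hl).le
  calc _ = m * (1 + lam) * ((m : ℝ)⁻¹ / (1 + lam) *
        ∑ j, (if β j * boolSign (z j).1 ≤ 0 then (1 : ℝ) else 0)) := by field_simp
    _ ≤ m * (1 + lam) * (δ * d) := h4
    _ = _ := by ring

end Design

/-! ### Averaging over finitely many label vectors -/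

section Averaging

/-- Partition the functions into lines in direction `j` and sum the bound over the lines. -/
theorem card_mul_le_sum_of_le_sum_update {ι α : Type*} [Fintype ι] [DecidableEq ι] [Fintype α]
    [Nonempty α] (f : (ι → α) → ℝ) (j : ι) {C : ℝ}
    (h : ∀ z, C ≤ ∑ a, f (Function.update z j a)) :
    C * Fintype.card (ι → α) ≤ Fintype.card α * ∑ z, f z := by
  classical
  let e := Equiv.funSplitAt j α
  let a₀ : α := Classical.arbitrary α
  have hcard : Fintype.card (ι → α) = Fintype.card α * Fintype.card ({i // i ≠ j} → α) := by
    rw [Fintype.card_congr e, Fintype.card_prod]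
  have hupd : ∀ a w, e.symm (a, w) = Function.update (e.symm (a₀, w)) j a := by
    intro a w
    ext i
    by_cases hi : i = j
    · subst hi; simp [e, Equiv.funSplitAt]
    · simp [e, Equiv.funSplitAt, hi]
  have hsum : C * Fintype.card ({i // i ≠ j} → α) ≤ ∑ z, f z := by
    rw [← e.symm.sum_comp, Fintype.sum_prod_type_right]
    calc C * Fintype.card ({i // i ≠ j} → α) = ∑ _w : {i // i ≠ j} → α, C := by
          simp [mul_comm]
      _ ≤ _ := Finset.sum_le_sum fun w _ => by
        rw [Finset.sum_congr rfl fun a _ => congrArg f (hupd a w)]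
        exact h (e.symm (a₀, w))
  rw [hcard, Nat.cast_mul]
  calc C * (Fintype.card α * Fintype.card ({i // i ≠ j} → α)) =
        Fintype.card α * (C * Fintype.card ({i // i ≠ j} → α)) := by ring
    _ ≤ _ := mul_le_mul_of_nonneg_left hsum (Nat.cast_nonneg _)

/-- The law of `y z` for uniformly distributed `z`. -/
noncomputable def uniformLaw {S β : Type*} [Fintype S] [MeasurableSpace β] (y : S → β) :
    Measure β :=
  (Fintype.card S : ENNReal)⁻¹ • Measure.sum fun z => Measure.dirac (y z)

variable {S β Ω : Type*} [Fintype S] [MeasurableSpace β] [MeasurableSpace Ω]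

instance [Nonempty S] (y : S → β) : IsProbabilityMeasure (uniformLaw y) := by
  constructor
  simp [uniformLaw, ENNReal.inv_mul_cancel]

theorem prod_uniformLaw (P : Measure Ω) [SFinite P] (y : S → β) :
    P.prod (uniformLaw y) =
      (Fintype.card S : ENNReal)⁻¹ • ∑ z, P.map fun ω => (ω, y z) := by
  rw [uniformLaw, Measure.prod_smul_right, Measure.prod_sum_right, Measure.sum_fintype]
  simp [Measure.prod_dirac]

theorem measurableEmbedding_prodMk_const [MeasurableSingletonClass β] (b : β) :
    MeasurableEmbedding fun ω : Ω => (ω, b) := by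
  refine ⟨fun ω ω' h => (Prod.ext_iff.1 h).1, measurable_prodMk_right, fun s hs => ?_⟩
  have : (fun ω : Ω => (ω, b)) '' s = s ×ˢ {b} := by
    ext ⟨ω, c⟩
    simp [eq_comm]
  rw [this]
  exact hs.prod (measurableSet_singleton b)

/-- Each slice `ω ↦ (ω, y z)` is a measurable embedding, so `E` may be arbitrary and joint
measurability of the success event is never needed. -/
theorem real_prod_uniformLaw [MeasurableSingletonClass β] (P : Measure Ω) [IsFiniteMeasure P]
    (y : S → β) (E : Set (Ω × β)) :
    (P.prod (uniformLaw y)).real E =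
      (Fintype.card S : ℝ)⁻¹ * ∑ z, P.real {ω | (ω, y z) ∈ E} := by
  rw [prod_uniformLaw, Measure.real, Measure.smul_apply, Measure.finsetSum_apply, smul_eq_mul,
    ENNReal.toReal_mul, ENNReal.toReal_inv, ENNReal.toReal_natCast]
  simp only [(measurableEmbedding_prodMk_const _).map_apply]
  rw [ENNReal.toReal_sum fun z _ => measure_ne_top _ _]
  rfl

theorem integral_prod_uniformLaw [MeasurableSingletonClass β] (P : Measure Ω) [IsFiniteMeasure P]
    (y : S → β) (f : Ω × β → ℝ) (hf : ∀ z, Integrable (fun ω => f (ω, y z)) P) :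
    ∫ p, f p ∂(P.prod (uniformLaw y)) =
      (Fintype.card S : ℝ)⁻¹ * ∑ z, ∫ ω, f (ω, y z) ∂P := by
  rw [prod_uniformLaw, integral_smul_measure, integral_finsetSum_measure]
  · simp [(measurableEmbedding_prodMk_const _).integral_map]
  · intro z _
    exact (measurableEmbedding_prodMk_const (y z)).integrable_map_iff.2 (hf z)

end Averaging

/-! ### The query lower bound -/

namespace ActiveLearner

variable {Ω : Type*} [MeasurableSpace Ω] {d m : ℕ}

/-- The block to which a row of `blockDesign d m` belongs. -/
def blockOf (i : Fin (d * m)) : Fin d := (finProdFinEquiv.symm i).1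

/-- At least `m - h` needle positions avoid the points queried in a needle-free reference run. At
such a position, either some sign triggers `h` queries or both signs yield the same output, which is
wrong for one of them. -/
theorem le_sum_update_wrong_add_many (A : ActiveLearner Ω (d * m) d) (ω : Ω) (h : ℕ)
    (z : Fin d → Bool × Fin m) (j : Fin d) :
    (m : ℝ) - h ≤ ∑ a, ((if A.estimate ω (needleLabels (Function.update z j a)) j *
        boolSign (Function.update z j a j).1 ≤ 0 then (1 : ℝ) else 0) +
      (if h ≤ A.blockCount ω (needleLabels (Function.update z j a)) blockOf j A.rounds
        then (1 : ℝ) else 0)) := by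
  classical
  -- Reference labels: the needle of block `j` is erased.
  let y₀ : Fin (d * m) → ℝ := fun i => if blockOf i = j then 0 else needleLabels z i
  obtain ⟨T, hTh, hT⟩ := A.exists_queried_finset ω y₀ blockOf j h
  have hcard : (Finset.univ.filter fun k : Fin m => finProdFinEquiv (j, k) ∈ T).card ≤ h := by
    refine le_trans (Finset.card_le_card_of_injOn (fun k => finProdFinEquiv (j, k)) ?_ ?_) hTh
    · intro k hk
      simpa using hk
    · intro k _ k' _ hkk
      simpa using hkk
  rw [Fintype.sum_prod_type_right]
  calc (m : ℝ) - h
      ≤ m - (Finset.univ.filter fun k : Fin m => finProdFinEquiv (j, k) ∈ T).card := by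
        gcongr
    _ = ∑ k : Fin m, (1 - if finProdFinEquiv (j, k) ∈ T then (1 : ℝ) else 0) := by
        simp [Finset.sum_sub_distrib]
    _ ≤ _ := Finset.sum_le_sum fun k _ => ?_
  have hnn : ∀ (p : Prop) [Decidable p], (0 : ℝ) ≤ if p then 1 else 0 := fun p _ => by
    split_ifs <;> norm_num
  by_cases hk : finProdFinEquiv (j, k) ∈ T
  · simp only [hk, if_true, sub_self]
    exact Finset.sum_nonneg fun s _ => add_nonneg (hnn _) (hnn _)
  · simp only [hk, if_false, sub_zero, Fintype.sum_bool, Function.update_self]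
    have hrun : ∀ s : Bool, h ≤ A.blockCount ω (needleLabels (Function.update z j (s, k)))
        blockOf j A.rounds ∨
        A.estimate ω (needleLabels (Function.update z j (s, k))) = A.estimate ω y₀ := by
      intro s
      refine hT _ (fun i hi => ?_) (fun i hi => ?_)
      · have hi' : (finProdFinEquiv.symm i).1 ≠ j := hi
        simp only [y₀, hi, if_false, needleLabels, Function.update_of_ne hi']
      · by_cases hij : blockOf i = j
        · have hij' : (finProdFinEquiv.symm i).1 = j := hij
          have hki : k ≠ (finProdFinEquiv.symm i).2 := by
            rintro rfl
            apply hk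
            rw [← hij']
            rwa [Prod.mk.eta, Equiv.apply_symm_apply]
          simp only [y₀, hij, if_true, needleLabels, hij', Function.update_self, hki, if_false]
        · have hij' : (finProdFinEquiv.symm i).1 ≠ j := hij
          simp only [y₀, hij, if_false, needleLabels, Function.update_of_ne hij']
    rcases hrun true with h1 | h1
    · rw [if_pos h1]
      have := hnn (A.estimate ω (needleLabels (Function.update z j (true, k))) j *
        boolSign true ≤ 0)
      have := hnn (A.estimate ω (needleLabels (Function.update z j (false, k))) j *
        boolSign false ≤ 0)
      have := hnn (h ≤ A.blockCount ω (needleLabels (Function.update z j (false, k)))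
        blockOf j A.rounds)
      linarith
    rcases hrun false with h2 | h2
    · rw [if_pos h2]
      have := hnn (A.estimate ω (needleLabels (Function.update z j (true, k))) j *
        boolSign true ≤ 0)
      have := hnn (A.estimate ω (needleLabels (Function.update z j (false, k))) j *
        boolSign false ≤ 0)
      have := hnn (h ≤ A.blockCount ω (needleLabels (Function.update z j (true, k)))
        blockOf j A.rounds)
      linarith
    have e1 := hnn (h ≤ A.blockCount ω (needleLabels (Function.update z j (true, k)))
        blockOf j A.rounds)
    have e2 := hnn (h ≤ A.blockCount ω (needleLabels (Function.update z j (false, k)))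
        blockOf j A.rounds)
    have e3 : (1 : ℝ) ≤ (if A.estimate ω y₀ j * boolSign true ≤ 0 then 1 else 0) +
        (if A.estimate ω y₀ j * boolSign false ≤ 0 then 1 else 0) := by
      simp only [boolSign, if_true, Bool.false_eq_true, if_false]
      split_ifs <;> first | (exfalso; linarith) | norm_num
    rw [h1, h2]
    linarith

/-- On average over the labels, coordinates with the wrong sign and queries are not both rare. -/
theorem card_mul_le_sum_wrong_add_queryCount (A : ActiveLearner Ω (d * m) d) (ω : Ω) {h : ℕ}
    (hh : 0 < h) (hm : m = 4 * h) :
    3 / 8 * (d : ℝ) * Fintype.card (Fin d → Bool × Fin m) ≤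
      ∑ z : Fin d → Bool × Fin m,
        (∑ j, (if A.estimate ω (needleLabels z) j * boolSign (z j).1 ≤ 0 then (1 : ℝ) else 0) +
          A.queryCount ω (needleLabels z) / h) := by
  have hh' : (0 : ℝ) < h := by exact_mod_cast hh
  have hmR : (m : ℝ) = 4 * h := by exact_mod_cast hm
  have : NeZero m := ⟨by omega⟩
  have hblock : ∀ j : Fin d, 3 / 8 * (Fintype.card (Fin d → Bool × Fin m) : ℝ) ≤
      ∑ z : Fin d → Bool × Fin m,
        ((if A.estimate ω (needleLabels z) j * boolSign (z j).1 ≤ 0 then (1 : ℝ) else 0) +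
        (if h ≤ A.blockCount ω (needleLabels z) blockOf j A.rounds then (1 : ℝ) else 0)) := by
    intro j
    have := card_mul_le_sum_of_le_sum_update (fun z : Fin d → Bool × Fin m =>
      (if A.estimate ω (needleLabels z) j * boolSign (z j).1 ≤ 0 then (1 : ℝ) else 0) +
        (if h ≤ A.blockCount ω (needleLabels z) blockOf j A.rounds then (1 : ℝ) else 0)) j
      (fun z => A.le_sum_update_wrong_add_many ω h z j)
    rw [Fintype.card_prod, Fintype.card_bool, Fintype.card_fin, Nat.cast_mul, hmR] at this
    -- A block has `2m = 8h` states and the bad weight is at least `m - h = 3h`, whence `3/8`.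
    rw [← mul_le_mul_iff_right₀ (show (0 : ℝ) < 8 * h by positivity)]
    push_cast at this ⊢
    linarith
  calc 3 / 8 * (d : ℝ) * Fintype.card (Fin d → Bool × Fin m)
      = ∑ _j : Fin d, 3 / 8 * (Fintype.card (Fin d → Bool × Fin m) : ℝ) := by
        rw [Finset.sum_const, Finset.card_univ, Fintype.card_fin, nsmul_eq_mul]; ring
    _ ≤ _ := Finset.sum_le_sum fun j _ => hblock j
    _ ≤ _ := by
        rw [Finset.sum_comm]
        refine Finset.sum_le_sum fun z _ => ?_
        rw [Finset.sum_add_distrib, ← A.sum_blockCount ω (needleLabels z) blockOf, Nat.cast_sum,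
          Finset.sum_div]
        gcongr with j
        rw [le_div_iff₀ hh']
        split_ifs with hq
        · simpa using hq
        · simp

theorem mul_div_le_integral_queryCount {h : ℕ} (hh : 0 < h) (hm : m = 4 * h) {lam δ : ℝ}
    (hlam : 0 ≤ lam) (hδ : 0 ≤ δ) (hδm : δ * (1 + lam) * m ≤ 1 / 16) (P : Measure Ω)
    [IsProbabilityMeasure P] (A : ActiveLearner Ω (d * m) d)
    (hA : 3 / 4 ≤ (P.prod (uniformLaw (needleLabels (d := d) (m := m)))).real
      {p : Ω × (Fin (d * m) → ℝ) | ridgeLoss lam (blockDesign d m) p.2 (A.estimate p.1 p.2)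
        ≤ (1 + δ) * ridgeOpt lam (blockDesign d m) p.2}) :
    (h : ℝ) * d / 16 ≤
      ∫ p, (A.queryCount p.1 p.2 : ℝ) ∂(P.prod (uniformLaw (needleLabels (d := d) (m := m)))) := by
  classical
  have hm0 : 0 < m := by omega
  have : NeZero m := ⟨hm0.ne'⟩
  have hh' : (0 : ℝ) < h := by exact_mod_cast hh
  set N : ℝ := (Fintype.card (Fin d → Bool × Fin m) : ℝ) with hN
  have hN0 : 0 < N := by rw [hN]; exact_mod_cast Fintype.card_pos
  rw [real_prod_uniformLaw] at hA
  rw [integral_prod_uniformLaw P _ _ fun z => A.integrable_queryCount P (needleLabels z)]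
  rw [← hN] at hA ⊢
  let E : (Fin d → Bool × Fin m) → Set Ω := fun z =>
    {ω | ridgeLoss lam (blockDesign d m) (needleLabels z) (A.estimate ω (needleLabels z))
      ≤ (1 + δ) * ridgeOpt lam (blockDesign d m) (needleLabels z)}
  have hE : ∀ z, MeasurableSet (E z) := by
    intro z
    refine measurableSet_le ?_ measurable_const
    simp only [ridgeLoss_blockDesign hm0]
    have := fun j => (measurable_pi_apply j).comp (A.measurable_estimate (needleLabels z))
    simp only [Function.comp_def] at this
    fun_prop
  change 3 / 4 ≤ N⁻¹ * ∑ z, P.real (E z) at hA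
  -- Wrong signs number at most `d / 16` on success and `d` on failure; `17/16 d - d 1_E` dominates
  -- both and is linear in the success indicator.
  have hpt : ∀ ω, 3 / 8 * (d : ℝ) * N ≤ ∑ z, (17 / 16 * (d : ℝ) - d * (E z).indicator 1 ω +
      (A.queryCount ω (needleLabels z) : ℝ) / h) := by
    intro ω
    refine (A.card_mul_le_sum_wrong_add_queryCount ω hh hm).trans ?_
    refine Finset.sum_le_sum fun z _ => ?_
    gcongr
    by_cases hω : ω ∈ E z
    · have := card_wrong_le hm0 hlam hδ z _ hω
      rw [Set.indicator_of_mem hω, Pi.one_apply]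
      nlinarith [mul_le_mul_of_nonneg_right hδm (Nat.cast_nonneg (α := ℝ) d)]
    · rw [Set.indicator_of_notMem hω]
      calc _ ≤ ∑ _j : Fin d, (1 : ℝ) := Finset.sum_le_sum fun j _ => by split_ifs <;> norm_num
        _ ≤ _ := by
          simp only [Finset.sum_const, Finset.card_univ, Fintype.card_fin, nsmul_eq_mul]
          linarith [Nat.cast_nonneg (α := ℝ) d]
  have hind : ∀ z, Integrable (fun ω => (d : ℝ) * (E z).indicator 1 ω) P := fun z =>
    ((integrable_const (1 : ℝ)).indicator (hE z)).const_mul _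
  have hq : ∀ z : Fin d → Bool × Fin m,
      Integrable (fun ω => (A.queryCount ω (needleLabels z) : ℝ) / h) P := fun z =>
    (A.integrable_queryCount P _).div_const _
  have hc : ∀ z, Integrable (fun ω => 17 / 16 * (d : ℝ) - d * (E z).indicator 1 ω) P := fun z =>
    (integrable_const _).sub (hind z)
  have hint := integral_mono (μ := P) (integrable_const (3 / 8 * (d : ℝ) * N))
    (integrable_finsetSum _ fun z _ => (hc z).add (hq z)) hpt
  rw [integral_const, integral_finsetSum _ fun z _ => (hc z).add (hq z)] at hint
  have hz : ∀ z : Fin d → Bool × Fin m, ∫ ω, (17 / 16 * (d : ℝ) - d * (E z).indicator 1 ω +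
      A.queryCount ω (needleLabels z) / h) ∂P = 17 / 16 * d - d * P.real (E z) +
        (∫ ω, (A.queryCount ω (needleLabels z) : ℝ) ∂P) / h := by
    intro z
    rw [integral_add (hc z) (hq z), integral_sub (integrable_const _) (hind z),
      integral_const_mul (d : ℝ) ((E z).indicator 1), integral_indicator_one (hE z), integral_div]
    simp
  simp only [Pi.add_apply, hz, Finset.sum_add_distrib, Finset.sum_sub_distrib,
    ← Finset.mul_sum, ← Finset.sum_div] at hint
  simp only [probReal_univ, one_smul, Finset.sum_const, Finset.card_univ, nsmul_eq_mul,
    ← hN] at hint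
  have hsucc : 3 / 4 * N ≤ ∑ z, P.real (E z) := by
    rw [← div_eq_inv_mul, le_div_iff₀ hN0] at hA
    exact hA
  set Q := ∑ z : Fin d → Bool × Fin m, ∫ ω, (A.queryCount ω (needleLabels z) : ℝ) ∂P
  have hd := mul_le_mul_of_nonneg_left hsucc (Nat.cast_nonneg (α := ℝ) d)
  have hfin : (d : ℝ) * N / 16 ≤ Q / h := by linarith
  rw [le_div_iff₀ hh'] at hfin
  rw [← div_eq_inv_mul, le_div_iff₀ hN0]
  linarith

end ActiveLearner

theorem mainTheorem3 :
    ∃ c : ℝ, 0 < c ∧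
      ∀ (d : ℕ) (ε lam : ℝ), 0 < ε → ε ≤ 1 / 100 → 1 ≤ lam → lam ≤ 50 →
        ∃ (n : ℕ) (X : Matrix (Fin n) (Fin d) ℝ) (μ : Measure (Fin n → ℝ)),
          IsProbabilityMeasure μ ∧
          statDim lam X = d / (1 + lam) ∧
          ∀ (Ω : Type*) [MeasurableSpace Ω] (P : Measure Ω) [IsProbabilityMeasure P]
            (A : ActiveLearner Ω n d),
            3 / 4 ≤ (P.prod μ).real {p : Ω × (Fin n → ℝ) |
                ridgeLoss lam X p.2 (A.estimate p.1 p.2)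
                  ≤ (1 + ε / 1000) * ridgeOpt lam X p.2} →
            c * (statDim lam X / ε) ≤ ∫ p, (A.queryCount p.1 p.2 : ℝ) ∂(P.prod μ) := by
  refine ⟨1 / 2, by norm_num, fun d ε lam hε hε' hlam hlam' => ?_⟩
  have hl : 0 < 1 + lam := by linarith
  have hden : 0 < ε * (1 + lam) := by positivity
  have hden' : ε * (1 + lam) ≤ 51 / 100 := by nlinarith
  -- With `δ = ε / 1000` and `m = 4h`, the condition `δ (1 + lam) m ≤ 1/16` says `h ≤ x`. The upper
  -- bounds on `ε` and `lam` give `x ≥ 30`, so taking the floor loses little and `c = 1/2` leaves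
  -- room.
  set x : ℝ := 1000 / (64 * (ε * (1 + lam))) with hx
  have hxd : x * (ε * (1 + lam)) = 1000 / 64 := by rw [hx]; field_simp
  have hx30 : 30 ≤ x := by
    rw [hx, le_div_iff₀ (by positivity)]
    linarith
  obtain ⟨h, hh⟩ : ∃ h : ℕ, h = ⌊x⌋₊ := ⟨_, rfl⟩
  have hhx : (h : ℝ) ≤ x := hh ▸ Nat.floor_le (by linarith)
  have hxh : x < h + 1 := hh ▸ Nat.lt_floor_add_one x
  have hh0 : 0 < h := by
    have : (0 : ℝ) < h := by linarith
    exact_mod_cast this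
  have : NeZero (4 * h) := ⟨by omega⟩
  have hsd : statDim lam (blockDesign d (4 * h)) = d / (1 + lam) :=
    statDim_eq_of_transpose_mul_self (blockDesign_transpose_mul_self (by omega)) lam
  refine ⟨d * (4 * h), blockDesign d (4 * h), uniformLaw needleLabels, inferInstance, hsd, ?_⟩
  intro Ω _ P _ A hA
  refine le_trans ?_
    (A.mul_div_le_integral_queryCount hh0 rfl (by linarith) (by positivity) ?_ P hA)
  · have e : (d : ℝ) / (1 + lam) / ε = d * (64 / 1000 * x) := by rw [hx]; field_simp
    rw [hsd, e]
    nlinarith [Nat.cast_nonneg (α := ℝ) d]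
  · push_cast
    nlinarith [mul_le_mul_of_nonneg_right hhx hden.le]
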